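/- All vector lattices are real and Archimedean. Let $X$ be a vector lattice, let $(E,\tau)$ be a Hausdorff locally solid vector lattice (a vector lattice with a Hausdorff linear topology that has a base at zero consisting of solid sets), and let $p\colon X\to E_+$ be a monotone vector norm, that is, $p(x)=0\Leftrightarrow x=0$, $p(\lambda x)=|\lambda|p(x)$, $p(x+y)\le p(x)+p(y)$, and $|x|\le|y|$ implies $p(x)\le p(y)$; such a triple $(X,p,E_\tau)$ is called a lattice-normed locally solid vector lattice (LNLS). A net $(x_\alpha)$ in $X$ is said to $up_\tau$-converge to $x$ in $(X,p,E_\tau)$ if $p(|x_\alpha-x|\wedge u)\xrightarrow{\tau}0$ for every $u\in X_+$. Let $\tilde X$ be the order (Dedekind) completion of $X$, that is, an order complete vector lattice that contains $X$ as a vector sublattice and in which every element is the supremum of the elements of $X$ below it and the infimum of the elements of $X$ above it. Suppose that $(\tilde X,p,E_\tau)$ is an LNLS whose norm extends the norm $p$ of $X$. Then $X$ is majorizing in $\tilde X$ (every element of $\tilde X$ lies below some element of $X$), and every net $(x_\alpha)$ in $X$ that $up_\tau$-converges to $0$ in $(X,p,E_\tau)$ also $up_\tau$-converges to $0$ in $(\tilde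 X,p,E_\tau)$. -/

import Mathlib

open Filter Topology

/-- The Archimedean property of a vector lattice: if the multiples `n • x` are bounded above
by one element, then `x ≤ 0`. (Mathlib's `Archimedean` is a different, much stronger property,
which makes every strictly positive element an order unit.) -/
class ArchimedeanRiesz (X : Type*) [AddCommGroup X] [Lattice X] : Prop where
  nonpos_of_nsmul_le : ∀ x y : X, (∀ n : ℕ, n • x ≤ y) → x ≤ 0

/-- The topology of `E` has a base at zero consisting of solid sets. -/
class LocallySolid (E : Type*) [AddCommGroup E] [Lattice E] [TopologicalSpace E] : Prop where
  hasBasis_solid : (𝓝 (0 : E)).HasBasis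
    (fun s : Set E => s ∈ 𝓝 (0 : E) ∧ LatticeOrderedAddCommGroup.IsSolid s) id

/-- `p` is a monotone `E`-valued vector norm on the vector lattice `X`, that is, `(X, p, E)` is
a lattice-normed vector lattice. -/
structure IsLatticeNorm {X E : Type*} [AddCommGroup X] [Lattice X] [Module ℝ X]
    [AddCommGroup E] [Lattice E] [Module ℝ E] (p : X → E) : Prop where
  nonneg : ∀ x, 0 ≤ p x
  eq_zero_iff : ∀ x, p x = 0 ↔ x = 0
  map_smul : ∀ (r : ℝ) (x : X), p (r • x) = |r| • p x
  add_le : ∀ x y, p (x + y) ≤ p x + p y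
  mono : ∀ x y, |x| ≤ |y| → p x ≤ p y

/-- Unbounded `p_τ`-convergence of the net `x` to `x₀`. -/
def UpTauTendsto {X E A : Type*} [AddCommGroup X] [Lattice X] [AddCommGroup E]
    [TopologicalSpace E] [Preorder A] (p : X → E) (x : A → X) (x₀ : X) : Prop :=
  ∀ u : X, 0 ≤ u → Tendsto (fun a => p (|x a - x₀| ⊓ u)) atTop (𝓝 0)

/-- The vector lattice `Y`, together with the embedding `ι` of `X`, is an order (Dedekind)
completion of the vector lattice `X`: `ι` is an injective lattice homomorphism, `Y` is order
complete, and every element of `Y` is the supremum of the elements of `X` below it and the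
infimum of the elements of `X` above it. -/
structure IsOrderCompletion {X Y : Type*} [AddCommGroup X] [Lattice X] [Module ℝ X]
    [AddCommGroup Y] [Lattice Y] [Module ℝ Y] (ι : X →ₗ[ℝ] Y) : Prop where
  injective : Function.Injective ι
  map_sup : ∀ a b, ι (a ⊔ b) = ι a ⊔ ι b
  map_inf : ∀ a b, ι (a ⊓ b) = ι a ⊓ ι b
  exists_isLUB : ∀ s : Set Y, s.Nonempty → BddAbove s → ∃ y, IsLUB s y
  isLUB_below : ∀ y : Y, IsLUB (ι '' {x | ι x ≤ y}) y
  isGLB_above : ∀ y : Y, IsGLB (ι '' {x | y ≤ ι x}) y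

/-- `X` is majorizing in `Y`, where `X` is regarded as a part of `Y` through `ι`. -/
def IsMajorizing {X Y : Type*} [LE Y] (ι : X → Y) : Prop :=
  ∀ y : Y, ∃ x : X, y ≤ ι x

/-! Testing against `u` in the completion reduces to testing against a positive element of `X`: if
`u ≤ ι w`, then `|ι (x a)| ⊓ u ≤ ι (|x a| ⊓ |w|)`, so monotonicity of `q` bounds the `q`-values by
`p (|x a| ⊓ |w|)`, which tends to zero; solidity of the topology gives the squeeze. -/

/-- An order completion contains the original vector lattice as a majorizing sublattice. -/
theorem IsOrderCompletion.isMajorizing {X Y : Type*} [AddCommGroup X] [Lattice X] [Module ℝ X]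
    [AddCommGroup Y] [Lattice Y] [IsOrderedAddMonoid Y] [Module ℝ Y] {ι : X →ₗ[ℝ] Y}
    (hι : IsOrderCompletion ι) : IsMajorizing ι := by
  intro y
  by_contra! hy
  -- With no majorant in `X`, `y` is the infimum of the empty set, hence the top of `Y`; then `y + y
  -- ≤ y` forces `y ≤ 0 = ι 0`.
  have hadd : y + y ≤ y := (hι.isGLB_above y).2 <| by
    rintro _ ⟨x, hx, rfl⟩
    exact absurd hx (hy x)
  exact hy 0 (by simpa using hadd)

theorem IsOrderCompletion.map_abs {X Y : Type*} [AddCommGroup X] [Lattice X] [Module ℝ X]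
    [AddCommGroup Y] [Lattice Y] [Module ℝ Y] {ι : X →ₗ[ℝ] Y}
    (hι : IsOrderCompletion ι) (x : X) : ι |x| = |ι x| := by
  simp only [abs, hι.map_sup, map_neg]

/-- Squeezing at zero in a locally solid vector lattice. -/
theorem LocallySolid.tendsto_zero_of_le {E A : Type*} [AddCommGroup E] [Lattice E]
    [IsOrderedAddMonoid E] [TopologicalSpace E] [LocallySolid E] {l : Filter A} {f g : A → E}
    (hf : ∀ a, 0 ≤ f a) (hfg : ∀ a, f a ≤ g a) (hg : Tendsto g l (𝓝 0)) :
    Tendsto f l (𝓝 0) := by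
  rw [LocallySolid.hasBasis_solid.tendsto_right_iff]
  rintro s ⟨hs, hsolid⟩
  filter_upwards [hg hs] with a ha
  refine hsolid ha ?_
  rw [abs_of_nonneg (hf a), abs_of_nonneg ((hf a).trans (hfg a))]
  exact hfg a

theorem mainTheorem10
    {X Y E A : Type*}
    -- the vector lattice `X`
    [AddCommGroup X] [Lattice X] [IsOrderedAddMonoid X] [Module ℝ X] [IsOrderedModule ℝ X]
    [ArchimedeanRiesz X]
    -- the Hausdorff locally solid vector lattice `E`
    [AddCommGroup E] [Lattice E] [IsOrderedAddMonoid E] [Module ℝ E] [IsOrderedModule ℝ E]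
    [ArchimedeanRiesz E]
    [TopologicalSpace E] [IsTopologicalAddGroup E] [ContinuousSMul ℝ E] [T2Space E]
    [LocallySolid E]
    -- the order completion `Y` of `X`
    [AddCommGroup Y] [Lattice Y] [IsOrderedAddMonoid Y] [Module ℝ Y] [IsOrderedModule ℝ Y]
    (ι : X →ₗ[ℝ] Y) (hι : IsOrderCompletion ι)
    -- the lattice norm of `X`, and the one of `Y` which extends it
    (p : X → E) (hp : IsLatticeNorm p)
    (q : Y → E) (hq : IsLatticeNorm q) (hqp : ∀ x, q (ι x) = p x)
    -- the net
    [Preorder A] [IsDirectedOrder A] [Nonempty A] (x : A → X)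
    (hx : UpTauTendsto p x 0) :
    IsMajorizing ι ∧ UpTauTendsto q (fun a => ι (x a)) 0 := by
  refine ⟨hι.isMajorizing, fun u hu => ?_⟩
  obtain ⟨w, hw⟩ := hι.isMajorizing u
  -- `|w|` replaces `w` because test elements must be positive.
  refine LocallySolid.tendsto_zero_of_le (fun a => hq.nonneg _) (fun a => ?_)
    (hx |w| (abs_nonneg w))
  rw [← hqp, hι.map_inf, hι.map_abs, hι.map_abs, sub_zero, sub_zero]
  refine hq.mono _ _ ?_
  rw [abs_of_nonneg (le_inf (abs_nonneg _) hu),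
    abs_of_nonneg (le_inf (abs_nonneg _) (abs_nonneg _))]
  exact inf_le_inf_left _ (hw.trans (le_abs_self _))
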